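/- Let $\pi$ be a convex polygon with $n\ge 3$ vertices. An edge on $\pi$ is a set of two distinct vertices of $\pi$; an edge of $\pi$ is one whose convex hull is disjoint from the interior of $\pi$. Two distinct edges on $\pi$ cross when their convex hulls have non-disjoint (relative) interiors. A triangulation of $\pi$ is an inclusion-maximal set of pairwise non-crossing edges on $\pi$; its interior edges are those of its elements that are not edges of $\pi$. The flip-graph of $\pi$ has the triangulations of $\pi$ as its vertices, two of them being adjacent when they differ by a single edge (one is obtained from the other by exchanging exactly one edge for another), and $d(T,U)$ denotes the distance of $T$ and $U$ in this graph. For two distinct vertices $a,b$ of $\pi$, label the vertices clockwise as $v_0=a,v_1,\dots,v_{n-1}$. The length of the oriented edge $(a,b)$ is the index $l$ with $v_l=b$; the vertices $v_1,\dots,v_{l-1}$ are on the left of $(a,b)$, and the vertices $v_{l+1},\dots,v_{n-1}$ are on the right of $(a,b)$. Let $T$ be a triangulation of $\pi$ and let $(a,b)$ be an oriented edge on $\pi$ of length $l\le\lceil n/2\rceil-1$ such that $\{a,b\}\in T$. Let $\tilde\Omega(T,a,b)$ be the set of all triangulations $U$ of $\pi$ such that every interior edge shared by $T$ and $U$ is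 incident to $a$ or to $b$, and every vertex on the left of $(a,b)$ is incident to at least two interior edges of $U$. **Theorem.** Let $U\in\tilde\Omega(T,a,b)$, and let $m$ be the number of vertices $v$ on the right of $(a,b)$ such that $v$ is adjacent to $a$ or to $b$ by an interior edge of $T$ and $v$ is adjacent to some vertex that is not on the right of $(a,b)$ by an interior edge of $U$. Then $$d(T,U)\ \ge\ n-m+l-5 .$$ -/

import Mathlib

/-- The plane. -/
abbrev Plane : Type := EuclideanSpace ℝ (Fin 2)

/-- The doubled signed area of the triangle `p q r`. It is negative exactly when `p`, `q`, `r` are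
not collinear and make a clockwise turn. -/
noncomputable def signedArea (p q r : Plane) : ℝ :=
  (q 0 - p 0) * (r 1 - p 1) - (q 1 - p 1) * (r 0 - p 0)

/-- A convex polygon with `n ≥ 3` vertices, the vertices being labelled `0, …, n - 1` clockwise:
any three of them, in the order of their labels, make a (strict) clockwise turn. -/
structure ConvexPolygon (n : ℕ) where
  three_le : 3 ≤ n
  vertex : Fin n → Plane
  clockwise : ∀ i j k : Fin n, i < j → j < k → signedArea (vertex i) (vertex j) (vertex k) < 0

namespace ConvexPolygon

variable {n : ℕ}

/-- The polygon as a region of the plane. -/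
def region (π : ConvexPolygon n) : Set Plane :=
  convexHull ℝ (Set.range π.vertex)

/-- The convex hull of a set of two vertices. -/
def edgeHull (π : ConvexPolygon n) (e : Sym2 (Fin n)) : Set Plane :=
  convexHull ℝ (π.vertex '' {v | v ∈ e})

/-- The (relative) interior of the convex hull of a set of two vertices. -/
def edgeInterior (π : ConvexPolygon n) (e : Sym2 (Fin n)) : Set Plane :=
  Sym2.lift ⟨fun a b => openSegment ℝ (π.vertex a) (π.vertex b),
    fun a b => openSegment_symm ℝ (π.vertex a) (π.vertex b)⟩ e

/-- The edges of the polygon: their convex hull is disjoint from the interior of the polygon. -/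
def IsBoundary (π : ConvexPolygon n) (e : Sym2 (Fin n)) : Prop :=
  Disjoint (π.edgeHull e) (interior π.region)

/-- Two edges on the polygon cross if their convex hulls have non-disjoint interiors. -/
def Crosses (π : ConvexPolygon n) (e f : Sym2 (Fin n)) : Prop :=
  ¬ Disjoint (π.edgeInterior e) (π.edgeInterior f)

/-- A set of edges on the polygon (pairs of distinct vertices), no two distinct ones crossing. -/
def IsNoncrossing (π : ConvexPolygon n) (S : Set (Sym2 (Fin n))) : Prop :=
  (∀ e ∈ S, ¬ e.IsDiag) ∧ S.Pairwise fun e f => ¬ π.Crosses e f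

/-- A triangulation: a set of pairwise non-crossing edges that is maximal for inclusion. -/
structure Triangulation (π : ConvexPolygon n) where
  edges : Set (Sym2 (Fin n))
  maximal : Maximal π.IsNoncrossing edges

/-- The interior edges of a triangulation: those that are not edges of the polygon. -/
def Triangulation.interiorEdges {π : ConvexPolygon n} (T : π.Triangulation) :
    Set (Sym2 (Fin n)) :=
  {e | e ∈ T.edges ∧ ¬ π.IsBoundary e}

/-- The flip-graph: two triangulations are adjacent if they differ by a single edge, that is, if one
is obtained from the other by replacing exactly one edge by another edge. -/
def flipGraph (π : ConvexPolygon n) : SimpleGraph π.Triangulation where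
  Adj T U := (T.edges \ U.edges).ncard = 1 ∧ (U.edges \ T.edges).ncard = 1
  symm := ⟨fun _ _ h => ⟨h.2, h.1⟩⟩
  loopless := ⟨fun T h => by simp at h⟩

/-- The flip distance: the least number of flips that transform `T` into `U`. -/
noncomputable def flipDist {π : ConvexPolygon n} (T U : π.Triangulation) : ℕ∞ :=
  π.flipGraph.edist T U

/-- The length of the oriented edge `(a, b)`: the number of clockwise steps along the boundary that
lead from `a` to `b`. The subtraction is modulo `n`. -/
def orientedLength (a b : Fin n) : ℕ := (b - a).val

/-- The vertices on the left of `(a, b)`: those met strictly between `a` and `b` when going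
clockwise from `a` to `b`. -/
def leftOf (a b : Fin n) : Set (Fin n) :=
  {v | 0 < orientedLength a v ∧ orientedLength a v < orientedLength a b}

/-- The vertices on the right of `(a, b)`: those met strictly after `b` (and before returning to
`a`) when going clockwise from `a`. -/
def rightOf (a b : Fin n) : Set (Fin n) :=
  {v | orientedLength a b < orientedLength a v}

/-- The triangulations `U` that share with `T` only interior edges incident to `a` or to `b`, and
such that each vertex on the left of `(a, b)` is incident to at least two interior edges of `U`. -/
def omegaTilde {π : ConvexPolygon n} (T : π.Triangulation) (a b : Fin n) :
    Set π.Triangulation :=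
  {U | (∀ e ∈ T.interiorEdges ∩ U.interiorEdges, a ∈ e ∨ b ∈ e) ∧
    ∀ v ∈ leftOf a b, 2 ≤ {e | e ∈ U.interiorEdges ∧ v ∈ e}.ncard}

/-- The vertices on the right of `(a, b)` that are adjacent to `a` or to `b` by an interior edge of
`T` and to some vertex not on the right of `(a, b)` by an interior edge of `U`. -/
def linkedRight {π : ConvexPolygon n} (T U : π.Triangulation) (a b : Fin n) : Set (Fin n) :=
  {v | v ∈ rightOf a b ∧ (s(v, a) ∈ T.interiorEdges ∨ s(v, b) ∈ T.interiorEdges) ∧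
    ∃ w, w ∉ rightOf a b ∧ s(v, w) ∈ U.interiorEdges}

end ConvexPolygon

/-! The proof is a potential argument. Number the vertices clockwise from a, so that b becomes l,
and view triangulations as maximal non-crossing sets of chords `A i j` with i < j. The target U is
the fixed parameter `Q`, and `flipPotential` adds three defects of a triangulation relative to `Q`:
one-sided chords not in `Q`, left vertices with fewer than two chords to the right side, and right
vertices joined to [0, l] though `Q` does not join them.

A flip lowers the sum by at most one (`IsChordFlip.flipPotential_le`): the positions of the removed
and inserted chords relative to the cut between [0, l] and (l, n) allow only one of the three terms
to decrease, and that one by at most 1. The sum vanishes at U (`flipPotential_self`), because the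
degree condition sends every interior edge at a left vertex across the cut. So its value at T is a
lower bound for the distance.

At T that value is at least n + l - m - 5 (`le_flipPotential`). Apexes of triangles give at least n
- 2 - k one-sided chords outside `Q`, where k counts the right vertices joined to [0, l] by T; all l
- 1 left vertices are deficient, shielded by the chord (0, l); and at least k - m - 2 of the k
joined vertices are in excess.

The rest translates convex geometry into this combinatorics: chords cross exactly when their ends
interleave, and the edges of the polygon are those joining cyclic neighbours. -/

/-! ### Combinatorics of chord triangulations and flips. -/

/-- Maximal non-crossing sets of chords on `0, …, n - 1` in cyclic order, a chord being given by its
smaller and its larger end. -/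
structure IsChordTriangulation (n : ℕ) (A : ℕ → ℕ → Prop) : Prop where
  lt : ∀ {i j}, A i j → i < j
  bound : ∀ {i j}, A i j → j < n
  noncrossing : ∀ {i j k m}, A i j → A k m → ¬ (i < k ∧ k < j ∧ j < m)
  maximal : ∀ {i j}, i < j → j < n →
    (∀ k m, A k m → ¬ (i < k ∧ k < j ∧ j < m) ∧ ¬ (k < i ∧ i < m ∧ m < j)) → A i j

/-- The chords of `A'` are those of `A` with `(p, q)` exchanged for `(r, s)`. -/
structure IsChordFlip (A A' : ℕ → ℕ → Prop) (p q r s : ℕ) : Prop where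
  mem_left : A p q
  not_mem_left : ¬ A' p q
  mem_right : A' r s
  not_mem_right : ¬ A r s
  left : ∀ {i j}, A i j → (i = p ∧ j = q) ∨ A' i j
  right : ∀ {i j}, A' i j → (i = r ∧ j = s) ∨ A i j

namespace IsChordTriangulation

variable {n : ℕ} {A : ℕ → ℕ → Prop}

theorem first_last_mem (hA : IsChordTriangulation n A) (hn : 2 ≤ n) : A 0 (n - 1) :=
  hA.maximal (by omega) (by omega) fun k m h => by
    have := hA.bound h
    omega

/-- Every label other than the first and the last is the middle vertex of a triangle. -/
theorem exists_triangle (hA : IsChordTriangulation n A) {m : ℕ} (h0 : 0 < m) (hm : m + 1 < n) :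
    ∃ i j, A i j ∧ A i m ∧ A m j := by
  classical
  -- Take a shortest chord (i, j) passing over m. A chord crossing (i, m) or (m, j) would cross (i,
  -- j) or be a shorter chord over m, so maximality supplies both sides.
  have hex : ∃ d, ∃ i j, A i j ∧ i < m ∧ m < j ∧ j - i = d :=
    ⟨_, 0, n - 1, hA.first_last_mem (by omega), h0, by omega, rfl⟩
  obtain ⟨i, j, hij, him, hmj, hd⟩ := Nat.find_spec hex
  have hmin : ∀ k s, A k s → k < m → m < s → j - i ≤ s - k := fun k s h1 h2 h3 => by
    rw [hd]
    exact Nat.find_min' hex ⟨k, s, h1, h2, h3, rfl⟩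
  have hj := hA.bound hij
  refine ⟨i, j, hij, hA.maximal him (by omega) fun k s hks => ?_,
    hA.maximal hmj hj fun k s hks => ?_⟩
  · have h1 := hmin k s hks
    have h2 := hA.noncrossing hij hks
    have h3 := hA.noncrossing hks hij
    have h4 := hA.lt hks
    omega
  · have h1 := hmin k s hks
    have h2 := hA.noncrossing hij hks
    have h3 := hA.noncrossing hks hij
    have h4 := hA.lt hks
    omega

end IsChordTriangulation

namespace IsChordFlip

variable {n : ℕ} {A A' : ℕ → ℕ → Prop} {p q r s : ℕ}

theorem symm (h : IsChordFlip A A' p q r s) : IsChordFlip A' A r s p q :=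
  ⟨h.mem_right, h.not_mem_right, h.mem_left, h.not_mem_left, h.right, h.left⟩

/-- Otherwise the new chord would cross nothing in `A`, and maximality would already place it there.
-/
theorem crosses (hA : IsChordTriangulation n A) (hA' : IsChordTriangulation n A')
    (h : IsChordFlip A A' p q r s) : (p < r ∧ r < q ∧ q < s) ∨ (r < p ∧ p < s ∧ s < q) := by
  by_contra hc
  refine h.not_mem_right (hA.maximal (hA'.lt h.mem_right) (hA'.bound h.mem_right) fun k m hkm => ?_)
  rcases h.left hkm with ⟨rfl, rfl⟩ | h'
  · omega
  · have h1 := hA'.noncrossing h.mem_right h'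
    have h2 := hA'.noncrossing h' h.mem_right
    exact ⟨h1, h2⟩

/-- The sides of the quadrilateral in which a flip takes place, seen from the old chord. -/
theorem sides (hA : IsChordTriangulation n A) (hA' : IsChordTriangulation n A')
    (h : IsChordFlip A A' p q r s) {w x y z : ℕ}
    (hc : (w = p ∧ x = r ∧ y = q ∧ z = s) ∨ (w = r ∧ x = p ∧ y = s ∧ z = q))
    (hwx : w < x) (hxy : x < y) (hyz : y < z) : A w x ∧ A x y ∧ A y z ∧ A w z := by
  have hpn := hA.bound h.mem_left
  have hsn := hA'.bound h.mem_right
  -- Every chord of `A` other than the old diagonal avoids both diagonals, whereas a chord crossing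
  -- a side of the quadrilateral must cross a diagonal.
  have key : ∀ k m, A k m → (k < m) ∧ ((k = p ∧ m = q) ∨
      (¬ (p < k ∧ k < q ∧ q < m) ∧ ¬ (k < p ∧ p < m ∧ m < q) ∧
       ¬ (r < k ∧ k < s ∧ s < m) ∧ ¬ (k < r ∧ r < m ∧ m < s))) := fun k m hkm => by
    refine ⟨hA.lt hkm, (h.left hkm).imp_right fun h' => ?_⟩
    exact ⟨hA.noncrossing h.mem_left hkm, hA.noncrossing hkm h.mem_left,
      hA'.noncrossing h.mem_right h', hA'.noncrossing h' h.mem_right⟩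
  refine ⟨hA.maximal ?_ ?_ fun k m hkm => ?_, hA.maximal ?_ ?_ fun k m hkm => ?_,
    hA.maximal ?_ ?_ fun k m hkm => ?_, hA.maximal ?_ ?_ fun k m hkm => ?_⟩
  all_goals first
    | omega
    | (have := key k m hkm; omega)

end IsChordFlip

/-! ### The potential and its change under a flip. -/

section Potential

open Finset Classical

/-- The chords of `A` outside of `Q` that have both ends in `[0, l]` or both ends in `(l, n)`. -/
noncomputable def oneSidedChords (n l : ℕ) (Q A : ℕ → ℕ → Prop) : Finset (ℕ × ℕ) :=
  {e ∈ range n ×ˢ range n | A e.1 e.2 ∧ ¬ Q e.1 e.2 ∧ (e.2 ≤ l ∨ l < e.1)}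

/-- The elements of `(0, l)` that are joined by `A` to at most one element of `(l, n)`. -/
noncomputable def deficientLeft (l : ℕ) (A : ℕ → ℕ → Prop) : Finset ℕ :=
  {x ∈ Ioo 0 l | ¬ ∃ y z, y ≠ z ∧ l < y ∧ l < z ∧ A x y ∧ A x z}

/-- The elements of `(l, n)` that are joined to `[0, l]` by `A` but not by `Q`. -/
noncomputable def excessRight (n l : ℕ) (Q A : ℕ → ℕ → Prop) : Finset ℕ :=
  {y ∈ Ioo l n | (∃ x ≤ l, A x y) ∧ ¬ ∃ x ≤ l, Q x y}

/-- A quantity that a flip lowers by at most one. -/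
noncomputable def flipPotential (n l : ℕ) (Q A : ℕ → ℕ → Prop) : ℕ :=
  #(oneSidedChords n l Q A) + #(deficientLeft l A) + #(excessRight n l Q A)

variable {n l : ℕ} {Q A A' : ℕ → ℕ → Prop} {p q r s : ℕ}

theorem IsChordFlip.oneSidedChords_subset (h : IsChordFlip A A' p q r s) :
    oneSidedChords n l Q A ⊆ insert (p, q) (oneSidedChords n l Q A') := by
  rintro ⟨i, j⟩ hij
  simp only [oneSidedChords, mem_filter, mem_insert, Prod.mk.injEq] at hij ⊢
  rcases h.left hij.2.1 with h' | h'
  · exact Or.inl h'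
  · exact Or.inr ⟨hij.1, h', hij.2.2⟩

theorem IsChordFlip.oneSidedChords_subset_of_twoSided (h : IsChordFlip A A' p q r s)
    (hp : p ≤ l) (hq : l < q) : oneSidedChords n l Q A ⊆ oneSidedChords n l Q A' := by
  rintro ⟨i, j⟩ hij
  have := h.oneSidedChords_subset hij
  simp only [oneSidedChords, mem_filter, mem_insert, Prod.mk.injEq] at hij this ⊢
  rcases this with h' | h'
  · omega
  · exact h'

theorem IsChordFlip.deficientLeft_subset_insert (h : IsChordFlip A A' p q r s) :
    deficientLeft l A ⊆ insert r (deficientLeft l A') := by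
  intro x hx
  simp only [deficientLeft, mem_filter, mem_insert] at hx ⊢
  by_cases hxr : x = r
  · exact Or.inl hxr
  refine Or.inr ⟨hx.1, ?_⟩
  rintro ⟨y, z, hyz, hy, hz, h1, h2⟩
  exact hx.2 ⟨y, z, hyz, hy, hz, (h.right h1).resolve_left (by tauto),
    (h.right h2).resolve_left (by tauto)⟩

theorem IsChordFlip.deficientLeft_subset_of_oneSided_right (h : IsChordFlip A A' p q r s)
    (hrs : s ≤ l ∨ l < r) : deficientLeft l A ⊆ deficientLeft l A' := by
  intro x hx
  simp only [deficientLeft, mem_filter, mem_Ioo] at hx ⊢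
  refine ⟨hx.1, ?_⟩
  rintro ⟨y, z, hyz, hy, hz, h1, h2⟩
  exact hx.2 ⟨y, z, hyz, hy, hz, (h.right h1).resolve_left (by omega),
    (h.right h2).resolve_left (by omega)⟩

/-- Only x = r could stop being deficient. If the removed chord passes over r, it lies in [0, l] and
blocks the second chord that r already had to the right. Otherwise both its ends are to the right,
and the sides of the quadrilateral already join r to them. -/
theorem IsChordFlip.deficientLeft_subset_of_oneSided_left (hA : IsChordTriangulation n A)
    (hA' : IsChordTriangulation n A') (h : IsChordFlip A A' p q r s)
    (hpq : q ≤ l ∨ l < p) : deficientLeft l A ⊆ deficientLeft l A' := by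
  intro x hx
  have hx' := hx
  simp only [deficientLeft, mem_filter, mem_Ioo] at hx ⊢
  refine ⟨hx.1, ?_⟩
  have key : ∀ y z, y ≠ z → l < y → l < z → A' x y → A' x z → x = r → y = s → False := by
    rintro y z hyz hy hz h1 h2 rfl rfl
    have hxz : A x z := (h.right h2).resolve_left (by omega)
    rcases h.crosses hA hA' with hc | hc
    · have := hA.noncrossing h.mem_left hxz
      omega
    · obtain ⟨h3, -, -, h4⟩ := h.sides hA hA' (Or.inr ⟨rfl, rfl, rfl, rfl⟩) hc.1 hc.2.1 hc.2.2
      exact hx.2 ⟨p, q, by omega, by omega, by omega, h3, h4⟩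
  rintro ⟨y, z, hyz, hy, hz, h1, h2⟩
  refine hx.2 ⟨y, z, hyz, hy, hz, (h.right h1).resolve_left ?_, (h.right h2).resolve_left ?_⟩
  · rintro ⟨h3, h4⟩
    exact key y z hyz hy hz h1 h2 h3 h4
  · rintro ⟨h3, h4⟩
    exact key z y hyz.symm hz hy h2 h1 h3 h4

theorem IsChordFlip.excessRight_subset_insert (h : IsChordFlip A A' p q r s) :
    excessRight n l Q A ⊆ insert q (excessRight n l Q A') := by
  intro y hy
  simp only [excessRight, mem_filter, mem_insert] at hy ⊢
  obtain ⟨h1, ⟨x, hx, hxy⟩, h2⟩ := hy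
  rcases h.left hxy with h' | h'
  · exact Or.inl h'.2
  · exact Or.inr ⟨h1, ⟨x, hx, h'⟩, h2⟩

theorem IsChordFlip.excessRight_subset_of_oneSided_left (h : IsChordFlip A A' p q r s)
    (hpq : q ≤ l ∨ l < p) : excessRight n l Q A ⊆ excessRight n l Q A' := by
  intro y hy
  simp only [excessRight, mem_filter, mem_Ioo] at hy ⊢
  obtain ⟨h1, ⟨x, hx, hxy⟩, h2⟩ := hy
  exact ⟨h1, ⟨x, hx, (h.left hxy).resolve_left (by omega)⟩, h2⟩

/-- The end q of the removed chord stays joined to [0, l] through r, by a side of the quadrilateral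
that survives the flip. -/
theorem IsChordFlip.excessRight_subset_of_le (hA : IsChordTriangulation n A)
    (hA' : IsChordTriangulation n A') (h : IsChordFlip A A' p q r s)
    (hr : r ≤ l) : excessRight n l Q A ⊆ excessRight n l Q A' := by
  intro y hy
  simp only [excessRight, mem_filter] at hy ⊢
  obtain ⟨h1, ⟨x, hx, hxy⟩, h2⟩ := hy
  refine ⟨h1, ?_, h2⟩
  rcases h.left hxy with ⟨rfl, rfl⟩ | h'
  · refine ⟨r, hr, ?_⟩
    rcases h.crosses hA hA' with hc | hc
    · exact (h.symm.sides hA' hA (Or.inr ⟨rfl, rfl, rfl, rfl⟩) hc.1 hc.2.1 hc.2.2).2.1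
    · exact (h.symm.sides hA' hA (Or.inl ⟨rfl, rfl, rfl, rfl⟩) hc.1 hc.2.1 hc.2.2).2.2.2
  · exact ⟨x, hx, h'⟩

theorem IsChordFlip.flipPotential_le (hA : IsChordTriangulation n A)
    (hA' : IsChordTriangulation n A') (h : IsChordFlip A A' p q r s) :
    flipPotential n l Q A ≤ flipPotential n l Q A' + 1 := by
  unfold flipPotential
  have a1 := (card_le_card (h.oneSidedChords_subset (n := n) (l := l) (Q := Q))).trans
    (card_insert_le _ _)
  have b1 := (card_le_card (h.deficientLeft_subset_insert (l := l))).trans (card_insert_le _ _)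
  have c1 := (card_le_card (h.excessRight_subset_insert (n := n) (l := l) (Q := Q))).trans
    (card_insert_le _ _)
  -- Removing a one-sided chord affects only the first term. Removing a two-sided chord affects only
  -- the second if the new chord starts in [0, l], and only the third otherwise.
  by_cases hpq : q ≤ l ∨ l < p
  · have b2 := card_le_card (h.deficientLeft_subset_of_oneSided_left hA hA' hpq)
    have c2 := card_le_card (h.excessRight_subset_of_oneSided_left (n := n) (Q := Q) hpq)
    omega
  have a2 := card_le_card
    (h.oneSidedChords_subset_of_twoSided (n := n) (l := l) (Q := Q) (by omega) (by omega))
  by_cases hr : r ≤ l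
  · have c2 := card_le_card (h.excessRight_subset_of_le (Q := Q) hA hA' hr)
    omega
  · have b2 := card_le_card (h.deficientLeft_subset_of_oneSided_right (l := l) (by omega))
    omega

/-! ### The potential vanishes at the target. -/

/-- No chord of `Q` cuts off labels of `(0, l)` only. -/
theorem not_mem_of_two_le_degree (hQ : IsChordTriangulation n Q)
    (hdeg : ∀ x, 0 < x → x < l → ∃ y z, y ≠ z ∧ (Q x y ∨ Q y x) ∧ (Q x z ∨ Q z x) ∧
      x + 1 ≠ y ∧ y + 1 ≠ x ∧ x + 1 ≠ z ∧ z + 1 ≠ x) {i j : ℕ} (hj : j ≤ l) (hij : i + 2 ≤ j) :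
    ¬ Q i j := by
  induction hd : j - i using Nat.strong_induction_on generalizing i j with
  | _ d ih =>
    subst hd
    intro h
    -- A chord at i + 1 that avoids its neighbours is trapped under (i, j), so it is a shorter chord
    -- of the same kind.
    obtain ⟨y, -, -, hy, -, h1, h2, -⟩ := hdeg (i + 1) (by omega) (by omega)
    rcases hy with hy | hy
    · have h3 := hQ.lt hy
      have h4 := hQ.noncrossing h hy
      exact ih (y - (i + 1)) (by omega) (by omega) (by omega) rfl hy
    · have h3 := hQ.lt hy
      have h4 := hQ.noncrossing hy h
      omega

theorem flipPotential_self (hQ : IsChordTriangulation n Q)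
    (hdeg : ∀ x, 0 < x → x < l → ∃ y z, y ≠ z ∧ (Q x y ∨ Q y x) ∧ (Q x z ∨ Q z x) ∧
      x + 1 ≠ y ∧ y + 1 ≠ x ∧ x + 1 ≠ z ∧ z + 1 ≠ x) :
    flipPotential n l Q Q = 0 := by
  have key : ∀ x y, x < l → (Q x y ∨ Q y x) → x + 1 ≠ y → y + 1 ≠ x → l < y ∧ Q x y := by
    intro x y hx hxy h1 h2
    rcases hxy with h | h
    · have := hQ.lt h
      refine ⟨?_, h⟩
      by_contra hc
      exact not_mem_of_two_le_degree hQ hdeg (by omega) (by omega) h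
    · have := hQ.lt h
      exact absurd h (not_mem_of_two_le_degree hQ hdeg (by omega) (by omega))
  have h1 : oneSidedChords n l Q Q = ∅ := by
    ext e
    simp only [oneSidedChords, mem_filter, notMem_empty, iff_false]
    tauto
  have h2 : deficientLeft l Q = ∅ := by
    ext x
    simp only [deficientLeft, mem_filter, mem_Ioo, notMem_empty, iff_false, not_and, not_not]
    rintro ⟨hx0, hx⟩
    obtain ⟨y, z, hyz, hy, hz, h3, h4, h5, h6⟩ := hdeg x hx0 hx
    obtain ⟨hy1, hy2⟩ := key x y hx hy h3 h4
    obtain ⟨hz1, hz2⟩ := key x z hx hz h5 h6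
    exact ⟨y, z, hyz, hy1, hz1, hy2, hz2⟩
  have h3 : excessRight n l Q Q = ∅ := by
    ext e
    simp only [excessRight, mem_filter, notMem_empty, iff_false]
    exact fun h => h.2.2 h.2.1
  simp [flipPotential, h1, h2, h3]

/-! ### The potential at the start. -/

/-- The elements of `(l, n)` that are joined to `[0, l]` by `A`. -/
noncomputable def linkedChordEnds (n l : ℕ) (A : ℕ → ℕ → Prop) : Finset ℕ :=
  {y ∈ Ioo l n | ∃ x ≤ l, A x y}

/-- Each left vertex, and each right vertex not joined to [0, l], is the middle vertex of a triangle
whose long side is one-sided and outside `Q`. A chord is the long side of at most one triangle, so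
these chords are distinct. -/
theorem card_oneSidedChords_ge (hA : IsChordTriangulation n A) (hl : 1 ≤ l) (hln : l + 1 < n)
    (hab : A 0 l) (hNN : ∀ i j, j ≤ l → i + 2 ≤ j → ¬ Q i j)
    (hRR : ∀ i j, l < i → i + 2 ≤ j → A i j → ¬ Q i j) :
    n ≤ #(oneSidedChords n l Q A) + #(linkedChordEnds n l A) + 2 := by
  set M : Finset ℕ := Ioo 0 l ∪ (Ioo l n \ linkedChordEnds n l A) with hM
  have hMcard : #M + #(linkedChordEnds n l A) + 2 = n := by
    rw [hM, card_union_of_disjoint,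
      card_sdiff_of_subset (show linkedChordEnds n l A ⊆ Ioo l n from filter_subset _ _),
      Nat.card_Ioo,
      Nat.card_Ioo]
    · have := card_le_card (filter_subset (fun y => ∃ x ≤ l, A x y) (Ioo l n))
      rw [Nat.card_Ioo] at this
      unfold linkedChordEnds
      omega
    · rw [disjoint_left]
      intro x hx hx'
      simp only [mem_Ioo, mem_sdiff] at hx hx'
      omega
  have hex : ∀ m ∈ M, ∃ e ∈ oneSidedChords n l Q A, A e.1 m ∧ A m e.2 := by
    intro m hm
    simp only [hM, mem_union, mem_sdiff, mem_Ioo, linkedChordEnds, mem_filter, not_and] at hm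
    have hmn : 0 < m ∧ m + 1 < n := by
      rcases hm with hm | hm
      · omega
      -- The label n - 1 is joined to 0, hence is not in `M`.
      · refine ⟨by omega, ?_⟩
        by_contra hc
        refine hm.2 hm.1 ⟨0, by omega, ?_⟩
        have := hA.first_last_mem (by omega)
        rwa [show m = n - 1 by omega]
    obtain ⟨i, j, hij, him, hmj⟩ := hA.exists_triangle hmn.1 hmn.2
    have h1 := hA.lt him
    have h2 := hA.lt hmj
    have h3 := hA.bound hij
    refine ⟨(i, j), ?_, him, hmj⟩
    simp only [oneSidedChords, mem_filter, mem_product, mem_range]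
    rcases hm with hm | hm
    · have h4 := hA.noncrossing hab hmj
      have hjl : j ≤ l := by omega
      exact ⟨⟨by omega, h3⟩, hij, hNN i j hjl (by omega), Or.inl hjl⟩
    · have hli : l < i := by
        by_contra hc
        exact hm.2 hm.1 ⟨i, by omega, him⟩
      exact ⟨⟨by omega, h3⟩, hij, hRR i j hli (by omega) hij, Or.inr hli⟩
  choose! g hg1 hg2 hg3 using hex
  have hinj : Set.InjOn g M := by
    have key : ∀ m ∈ M, ∀ m' ∈ M, g m = g m' → ¬ m < m' := by
      intro m hm m' hm' h hlt
      have h1 := hg2 m' hm'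
      have h2 := hg3 m hm
      rw [← h] at h1
      have h3 := hA.lt (hg2 m hm)
      have h4 := hA.lt (hg3 m' hm')
      rw [← h] at h4
      exact hA.noncrossing h1 h2 ⟨h3, hlt, h4⟩
    intro m hm m' hm' h
    exact le_antisymm (not_lt.1 (key m' hm' m hm h.symm)) (not_lt.1 (key m hm m' hm' h))
  have := card_le_card_of_injOn g hg1 hinj
  omega

theorem card_deficientLeft (hA : IsChordTriangulation n A) (hab : A 0 l) :
    #(deficientLeft l A) = l - 1 := by
  rw [deficientLeft, filter_true_of_mem, Nat.card_Ioo]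
  · omega
  · rintro x hx ⟨y, -, -, hy, -, hxy, -⟩
    rw [mem_Ioo] at hx
    exact hA.noncrossing hab hxy ⟨hx.1, hx.2, hy⟩

/-- The initial value of the potential. -/
theorem le_flipPotential (hA : IsChordTriangulation n A) (hQ : IsChordTriangulation n Q)
    (hl : 1 ≤ l) (hln : l + 1 < n) (hab : A 0 l)
    (hdeg : ∀ x, 0 < x → x < l → ∃ y z, y ≠ z ∧ (Q x y ∨ Q y x) ∧ (Q x z ∨ Q z x) ∧
      x + 1 ≠ y ∧ y + 1 ≠ x ∧ x + 1 ≠ z ∧ z + 1 ≠ x)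
    (hRR : ∀ i j, l < i → i + 2 ≤ j → A i j → ¬ Q i j) :
    n + l ≤ flipPotential n l Q A +
      #{y ∈ Ioo (l + 1) (n - 1) | (A 0 y ∨ A l y) ∧ ∃ x ≤ l, Q x y} + 5 := by
  have h1 := card_oneSidedChords_ge (Q := Q) hA hl hln hab
    (fun i j hj hij => not_mem_of_two_le_degree hQ hdeg hj hij) hRR
  have h2 := card_deficientLeft hA hab
  -- The labels l + 1 and n - 1 are set aside since their links to l and 0 are polygon edges, not
  -- interior ones. Together with 2 from `h1` and 1 from `h2`, they make up the constant 5.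
  have h3 : linkedChordEnds n l A ⊆ (excessRight n l Q A ∪
      {y ∈ Ioo (l + 1) (n - 1) | (A 0 y ∨ A l y) ∧ ∃ x ≤ l, Q x y}) ∪ {l + 1, n - 1} := by
    intro y hy
    simp only [linkedChordEnds, excessRight, mem_filter, mem_union, mem_Ioo, mem_insert,
      mem_singleton] at hy ⊢
    obtain ⟨hy, x, hx, hxy⟩ := hy
    by_cases hB : y = l + 1 ∨ y = n - 1
    · exact Or.inr hB
    refine Or.inl ?_
    by_cases hc : ∃ x ≤ l, Q x y
    · refine Or.inr ⟨by omega, ?_, hc⟩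
      have h4 := hA.noncrossing hab hxy
      rcases Nat.eq_zero_or_pos x with rfl | h0
      · exact Or.inl hxy
      · rw [show x = l by omega] at hxy
        exact Or.inr hxy
    · exact Or.inl ⟨hy, ⟨x, hx, hxy⟩, hc⟩
  have h4 := card_le_card h3
  have h5 := card_union_le (excessRight n l Q A ∪
      {y ∈ Ioo (l + 1) (n - 1) | (A 0 y ∨ A l y) ∧ ∃ x ≤ l, Q x y}) {l + 1, n - 1}
  have h6 := card_union_le (excessRight n l Q A)
      {y ∈ Ioo (l + 1) (n - 1) | (A 0 y ∨ A l y) ∧ ∃ x ≤ l, Q x y}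
  have h7 : #({l + 1, n - 1} : Finset ℕ) ≤ 2 := card_le_two
  unfold flipPotential
  omega

end Potential

/-! ### Signed areas, triangles and segments in the plane. -/

theorem signedArea_rotate (p q r : Plane) : signedArea p q r = signedArea q r p := by
  unfold signedArea
  ring

theorem signedArea_swap (p q r : Plane) : signedArea q p r = - signedArea p q r := by
  unfold signedArea
  ring

theorem signedArea_left (p q : Plane) : signedArea p q p = 0 := by
  unfold signedArea
  ring

theorem signedArea_right (p q : Plane) : signedArea p q q = 0 := by
  unfold signedArea
  ring

theorem signedArea_combination (p q x y : Plane) {α β : ℝ} (h : α + β = 1) :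
    signedArea p q (α • x + β • y) = α * signedArea p q x + β * signedArea p q y := by
  obtain rfl : β = 1 - α := by linarith
  simp only [signedArea, PiLp.add_apply, PiLp.smul_apply, smul_eq_mul]
  ring

theorem continuous_signedArea (p q : Plane) : Continuous (signedArea p q) := by
  unfold signedArea
  fun_prop

theorem convex_signedArea_nonpos (p q : Plane) : Convex ℝ {r | signedArea p q r ≤ 0} := by
  intro x hx y hy α β hα hβ h
  simp only [Set.mem_ofPred_eq] at hx hy ⊢
  rw [signedArea_combination p q x y h]
  nlinarith [mul_nonneg hα (neg_nonneg.2 hx), mul_nonneg hβ (neg_nonneg.2 hy)]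

theorem convex_signedArea_zero (p q : Plane) : Convex ℝ {r | signedArea p q r = 0} := by
  intro x hx y hy α β _ _ h
  simp only [Set.mem_ofPred_eq] at hx hy ⊢
  rw [signedArea_combination p q x y h, hx, hy]
  ring

/-- Barycentric coordinates in a triangle. -/
theorem mem_convexHull_of_signedArea_nonpos {p q r x : Plane} {s : Set Plane} (hp : p ∈ s)
    (hq : q ∈ s) (hr : r ∈ s) (h : signedArea p q r < 0) (h1 : signedArea p q x ≤ 0)
    (h2 : signedArea q r x ≤ 0) (h3 : signedArea r p x ≤ 0) : x ∈ convexHull ℝ s := by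
  have hx : x = (signedArea q r x / signedArea p q r) • p +
      (signedArea r p x / signedArea p q r) • q + (signedArea p q x / signedArea p q r) • r := by
    have h' := h.ne
    ext i
    simp only [PiLp.add_apply, PiLp.smul_apply, smul_eq_mul]
    field_simp
    unfold signedArea
    fin_cases i <;> simp <;> ring
  have hsum : signedArea q r x / signedArea p q r + signedArea r p x / signedArea p q r +
      signedArea p q x / signedArea p q r = 1 := by
    have h' := h.ne
    field_simp
    unfold signedArea
    ring
  have hconv := convex_convexHull ℝ s
  have hs := subset_convexHull ℝ s
  have hmem := hconv.sum_mem (t := Finset.univ)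
    (w := ![signedArea q r x / signedArea p q r, signedArea r p x / signedArea p q r,
      signedArea p q x / signedArea p q r]) (z := ![p, q, r])
    (by
      intro i _
      fin_cases i
      · exact div_nonneg_of_nonpos h2 h.le
      · exact div_nonneg_of_nonpos h3 h.le
      · exact div_nonneg_of_nonpos h1 h.le)
    (by simpa [Fin.sum_univ_three] using hsum)
    (by
      intro i _
      fin_cases i
      · exact hs hp
      · exact hs hq
      · exact hs hr)
  rw [hx]
  simpa [Fin.sum_univ_three] using hmem

/-- If the area were 0 at an interior point x, moving x slightly away from r would stay in s and
make it positive. -/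
theorem signedArea_neg_of_mem_interior {p q r x : Plane} {s : Set Plane}
    (hs : s ⊆ {y | signedArea p q y ≤ 0}) (hr : signedArea p q r < 0) (hx : x ∈ interior s) :
    signedArea p q x < 0 := by
  refine lt_of_le_of_ne (hs (interior_subset hx)) fun h0 => ?_
  have hc : Continuous fun ε : ℝ => (1 + ε) • x + (-ε) • r := by fun_prop
  have hev : ∀ᶠ ε in nhds (0 : ℝ), (1 + ε) • x + (-ε) • r ∈ interior s := by
    refine hc.continuousAt.eventually_mem (isOpen_interior.mem_nhds ?_)
    simpa using hx
  obtain ⟨ε, hε, hε0⟩ := ((hev.filter_mono nhdsWithin_le_nhds).and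
    (self_mem_nhdsWithin (a := (0 : ℝ)) (s := Set.Ioi 0))).exists
  have h1 : signedArea p q ((1 + ε) • x + (-ε) • r) ≤ 0 := hs (interior_subset hε)
  rw [signedArea_combination p q x r (by ring), h0] at h1
  have h2 : 0 < ε := hε0
  nlinarith

theorem disjoint_openSegment_of_signedArea_nonneg {p q x y : Plane} (hx : 0 ≤ signedArea p q x)
    (hy : 0 ≤ signedArea p q y) (h : 0 < signedArea p q x ∨ 0 < signedArea p q y) :
    Disjoint (openSegment ℝ p q) (openSegment ℝ x y) := by
  rw [Set.disjoint_left]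
  rintro z ⟨α, β, -, -, hαβ, rfl⟩ ⟨γ, δ, hγ, hδ, hγδ, hz⟩
  have h1 := signedArea_combination p q p q hαβ
  rw [← hz, signedArea_combination p q x y hγδ, signedArea_left, signedArea_right] at h1
  rcases h with h | h
  · nlinarith [mul_pos hγ h, mul_nonneg hδ.le hy]
  · nlinarith [mul_pos hδ h, mul_nonneg hγ.le hx]

/-- The diagonals of a convex quadrilateral meet at the point dividing each in the ratio of the
triangles cut off by the other; `hD` computes the total area along either diagonal. -/
theorem not_disjoint_openSegment {p q x y : Plane} (h1 : signedArea p x q < 0)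
    (h2 : signedArea p q y < 0) (h3 : signedArea p x y < 0) (h4 : signedArea x q y < 0) :
    ¬ Disjoint (openSegment ℝ p q) (openSegment ℝ x y) := by
  rw [Set.not_disjoint_iff]
  have hD : signedArea p x q + signedArea p q y = signedArea p x y + signedArea x q y := by
    unfold signedArea
    ring
  refine ⟨(signedArea x q y / (signedArea p x q + signedArea p q y)) • p +
    (signedArea p x y / (signedArea p x q + signedArea p q y)) • q,
    ⟨_, _, div_pos_of_neg_of_neg h4 (by linarith), div_pos_of_neg_of_neg h3 (by linarith), ?_, rfl⟩,
    ⟨signedArea p q y / (signedArea p x q + signedArea p q y),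
      signedArea p x q / (signedArea p x q + signedArea p q y),
      div_pos_of_neg_of_neg h2 (by linarith), div_pos_of_neg_of_neg h1 (by linarith), ?_, ?_⟩⟩
  · rw [← add_div, div_eq_one_iff_eq (by linarith)]
    linarith
  · rw [← add_div, div_eq_one_iff_eq (by linarith)]
    linarith
  · have hne : signedArea p x q + signedArea p q y ≠ 0 := by linarith
    ext i
    simp only [PiLp.add_apply, PiLp.smul_apply, smul_eq_mul]
    field_simp
    unfold signedArea
    fin_cases i <;> simp <;> ring

/-! ### Clockwise labels from a, crossings and polygon edges. -/

namespace ConvexPolygon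

variable {n : ℕ}

/-- The vertex that is reached from `a` by `i` clockwise steps. -/
def step (a : Fin n) (i : ℕ) : Fin n :=
  ⟨(a.val + i) % n, Nat.mod_lt _ (Fin.pos a)⟩

theorem step_val (a : Fin n) {i : ℕ} (hi : i < n) :
    (a.val + i < n ∧ (step a i).val = a.val + i) ∨
      (n ≤ a.val + i ∧ (step a i).val = a.val + i - n) := by
  have ha := a.isLt
  unfold step
  rcases lt_or_ge (a.val + i) n with h | h
  · exact Or.inl ⟨h, Nat.mod_eq_of_lt h⟩
  · refine Or.inr ⟨h, ?_⟩
    simp only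
    rw [Nat.mod_eq_sub_mod h, Nat.mod_eq_of_lt (by omega)]

theorem orientedLength_lt (a v : Fin n) : orientedLength a v < n := (v - a).isLt

theorem orientedLength_step (a : Fin n) {i : ℕ} (hi : i < n) : orientedLength a (step a i) = i := by
  have h := step_val a hi
  have ha := a.isLt
  unfold orientedLength
  rw [Fin.val_sub]
  rcases h with ⟨h1, h2⟩ | ⟨h1, h2⟩
  · rw [h2, show n - a.val + (a.val + i) = i + n by omega, Nat.add_mod_right, Nat.mod_eq_of_lt hi]
  · rw [h2, show n - a.val + (a.val + i - n) = i by omega, Nat.mod_eq_of_lt hi]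

theorem step_orientedLength (a v : Fin n) : step a (orientedLength a v) = v := by
  have ha := a.isLt
  have hv := v.isLt
  ext
  unfold orientedLength step
  simp only
  rw [Fin.val_sub, Nat.add_mod_mod, show a.val + (n - a.val + v.val) = v.val + n by omega,
    Nat.add_mod_right, Nat.mod_eq_of_lt hv]

theorem step_zero (a : Fin n) : step a 0 = a := by
  ext
  simp [step, Nat.mod_eq_of_lt a.isLt]

theorem step_inj (a : Fin n) {i j : ℕ} (hi : i < n) (hj : j < n) :
    step a i = step a j ↔ i = j := by
  refine ⟨fun h => ?_, fun h => h ▸ rfl⟩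
  rw [← orientedLength_step a hi, h, orientedLength_step a hj]

theorem exists_step (a v : Fin n) : ∃ i, i < n ∧ v = step a i :=
  ⟨_, orientedLength_lt a v, (step_orientedLength a v).symm⟩

theorem exists_chord (a : Fin n) {e : Sym2 (Fin n)} (he : ¬ e.IsDiag) :
    ∃ i j, i < j ∧ j < n ∧ e = s(step a i, step a j) := by
  induction e with
  | _ u v =>
    obtain ⟨i, hi, rfl⟩ := exists_step a u
    obtain ⟨j, hj, rfl⟩ := exists_step a v
    rw [Sym2.mk_isDiag_iff, step_inj a hi hj] at he
    rcases lt_or_gt_of_ne he with h | h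
    · exact ⟨i, j, h, hj, rfl⟩
    · exact ⟨j, i, h, hi, Sym2.eq_swap⟩

theorem chord_inj (a : Fin n) {i j k m : ℕ} (hij : i < j) (hj : j < n) (hkm : k < m) (hm : m < n)
    (h : s(step a i, step a j) = s(step a k, step a m)) : i = k ∧ j = m := by
  rw [Sym2.eq_iff, step_inj a (by omega) (by omega), step_inj a hj hm, step_inj a (by omega) hm,
    step_inj a hj (by omega)] at h
  omega

variable (π : ConvexPolygon n) (a : Fin n)

/-- Relabelling from a rotates the cyclic order, and signed area is invariant under rotation of its
arguments. -/
theorem clockwise_step {i j k : ℕ} (hij : i < j) (hjk : j < k) (hk : k < n) :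
    signedArea (π.vertex (step a i)) (π.vertex (step a j)) (π.vertex (step a k)) < 0 := by
  have hi := step_val a (i := i) (by omega)
  have hj := step_val a (i := j) (by omega)
  have hk' := step_val a hk
  have ha := a.isLt
  by_cases h1 : step a i < step a j
  · by_cases h2 : step a j < step a k
    · exact π.clockwise _ _ _ h1 h2
    · rw [← signedArea_rotate]
      refine π.clockwise _ _ _ ?_ h1
      rw [Fin.lt_def] at h1 h2 ⊢
      omega
  · rw [signedArea_rotate]
    refine π.clockwise _ _ _ ?_ ?_ <;> rw [Fin.lt_def] at h1 ⊢ <;> omega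

theorem signedArea_step_pos {i j k : ℕ} (hik : i < k) (hkj : k < j) (hj : j < n) :
    0 < signedArea (π.vertex (step a i)) (π.vertex (step a j)) (π.vertex (step a k)) := by
  have := π.clockwise_step a hik hkj hj
  rw [signedArea_rotate, signedArea_rotate, signedArea_swap] at this
  linarith

theorem signedArea_step_neg {i j k : ℕ} (hij : i < j) (hj : j < n) (hk : k < n)
    (h : k < i ∨ j < k) :
    signedArea (π.vertex (step a i)) (π.vertex (step a j)) (π.vertex (step a k)) < 0 := by
  rcases h with h | h
  · rw [← signedArea_rotate]
    exact π.clockwise_step a h hij hj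
  · exact π.clockwise_step a hij h hk

theorem crosses_of_interleaved {i j k m : ℕ} (hik : i < k) (hkj : k < j) (hjm : j < m)
    (hm : m < n) : π.Crosses s(step a i, step a j) s(step a k, step a m) :=
  not_disjoint_openSegment (π.clockwise_step a hik hkj (by omega))
    (π.clockwise_step a (by omega) hjm hm) (π.clockwise_step a hik (by omega) hm)
    (π.clockwise_step a hkj hjm hm)

theorem Crosses.symm {e f : Sym2 (Fin n)} (h : π.Crosses e f) : π.Crosses f e :=
  fun h' => h (Disjoint.symm h')

theorem not_crosses_of_not_interleaved {i j k m : ℕ} (hij : i < j) (hj : j < n) (hkm : k < m)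
    (hm : m < n) (hne : ¬ (i = k ∧ j = m)) (h1 : ¬ (i < k ∧ k < j ∧ j < m))
    (h2 : ¬ (k < i ∧ i < m ∧ m < j)) :
    ¬ π.Crosses s(step a i, step a j) s(step a k, step a m) := by
  rw [Crosses, not_not]
  have hin : ∀ x, i ≤ x → x ≤ j →
      0 ≤ signedArea (π.vertex (step a i)) (π.vertex (step a j)) (π.vertex (step a x)) := by
    intro x hix hxj
    rcases eq_or_lt_of_le hix with rfl | hix
    · rw [signedArea_left]
    rcases eq_or_lt_of_le hxj with rfl | hxj
    · rw [signedArea_right]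
    exact (π.signedArea_step_pos a hix hxj hj).le
  have hout : ∀ x, x < n → x ≤ i ∨ j ≤ x →
      0 ≤ signedArea (π.vertex (step a j)) (π.vertex (step a i)) (π.vertex (step a x)) := by
    intro x hx h
    rw [signedArea_swap]
    rcases eq_or_ne x i with rfl | hxi
    · rw [signedArea_left, neg_zero]
    rcases eq_or_ne x j with rfl | hxj
    · rw [signedArea_right, neg_zero]
    linarith [π.signedArea_step_neg a hij hj hx (by omega)]
  -- Without interleaving, k and m lie in the same closed arc cut off by (i, j), so one chord lies
  -- weakly on one side of the other; it does so strictly at one end, as the chords differ.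
  by_cases hc : i ≤ k ∧ m ≤ j
  · refine disjoint_openSegment_of_signedArea_nonneg (hin k (by omega) (by omega))
      (hin m (by omega) (by omega)) ?_
    by_cases hk : i = k
    · exact Or.inr (π.signedArea_step_pos a (by omega) (by omega) hj)
    · exact Or.inl (π.signedArea_step_pos a (by omega) (by omega) hj)
  · rw [Sym2.eq_swap (a := step a i)]
    refine disjoint_openSegment_of_signedArea_nonneg (hout k (by omega) (by omega))
      (hout m (by omega) (by omega)) ?_
    simp only [signedArea_swap (π.vertex (step a i)), Left.neg_pos_iff]
    by_cases hk : k = i ∨ k = j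
    · exact Or.inr (π.signedArea_step_neg a hij hj hm (by omega))
    · exact Or.inl (π.signedArea_step_neg a hij hj (by omega) (by omega))

theorem isBoundary_succ {i : ℕ} (hi : i + 1 < n) : π.IsBoundary s(step a i, step a (i + 1)) := by
  rw [IsBoundary, Set.disjoint_left]
  intro x hx hx'
  have h0 : signedArea (π.vertex (step a i)) (π.vertex (step a (i + 1))) x = 0 := by
    refine convexHull_min ?_ (convex_signedArea_zero (π.vertex (step a i))
      (π.vertex (step a (i + 1)))) hx
    rintro _ ⟨v, hv, rfl⟩
    rw [Set.mem_ofPred_eq, Sym2.mem_iff] at hv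
    rcases hv with rfl | rfl
    · exact signedArea_left _ _
    · exact signedArea_right _ _
  have hneg : ∀ k, k < n → k ≠ i → k ≠ i + 1 → signedArea (π.vertex (step a i))
      (π.vertex (step a (i + 1))) (π.vertex (step a k)) < 0 := fun k hk h1 h2 =>
    π.signedArea_step_neg a (by omega) hi hk (by omega)
  have hsub : π.region ⊆
      {y | signedArea (π.vertex (step a i)) (π.vertex (step a (i + 1))) y ≤ 0} := by
    refine convexHull_min ?_ (convex_signedArea_nonpos _ _)
    rintro _ ⟨v, rfl⟩
    obtain ⟨k, hk, rfl⟩ := exists_step a v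
    rw [Set.mem_ofPred_eq]
    by_cases h1 : k = i
    · rw [h1, signedArea_left]
    by_cases h2 : k = i + 1
    · rw [h2, signedArea_right]
    exact (hneg k hk h1 h2).le
  obtain ⟨k, hk, h1, h2⟩ : ∃ k, k < n ∧ k ≠ i ∧ k ≠ i + 1 := by
    have := π.three_le
    by_cases hi0 : i = 0
    · exact ⟨2, by omega, by omega, by omega⟩
    · exact ⟨0, by omega, by omega, by omega⟩
  exact (signedArea_neg_of_mem_interior hsub (hneg k hk h1 h2) hx').ne h0

theorem not_isBoundary {i j : ℕ} (hij : i + 2 ≤ j) (hj : j < n) (h0 : ¬ (i = 0 ∧ j + 1 = n)) :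
    ¬ π.IsBoundary s(step a i, step a j) := by
  obtain ⟨k, hk, hk'⟩ : ∃ k, k < n ∧ (k < i ∨ j < k) := by
    by_cases hi : i = 0
    · exact ⟨n - 1, by omega, by omega⟩
    · exact ⟨0, by omega, by omega⟩
  set u := π.vertex (step a i)
  set v := π.vertex (step a j)
  set x := π.vertex (step a (i + 1))
  set y := π.vertex (step a k)
  have huxv : signedArea u x v < 0 := π.clockwise_step a (by omega) (by omega) hj
  have huvy : signedArea u v y < 0 := π.signedArea_step_neg a (by omega) hj hk hk'
  have hmem : ∀ w, π.vertex w ∈ Set.range π.vertex := fun w => ⟨w, rfl⟩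
  rw [IsBoundary, Set.not_disjoint_iff]
  have hhalf : (1 / 2 : ℝ) + 1 / 2 = 1 := by norm_num
  refine ⟨(1 / 2 : ℝ) • u + (1 / 2 : ℝ) • v, ?_, ?_⟩
  · refine convex_convexHull ℝ _ (subset_convexHull ℝ _
      (Set.mem_image_of_mem π.vertex (Sym2.mem_mk_left (step a i) (step a j))))
      (subset_convexHull ℝ _
      (Set.mem_image_of_mem π.vertex (Sym2.mem_mk_right (step a i) (step a j)))) ?_ ?_ hhalf <;> norm_num
  rw [mem_interior]
  -- This is the open quadrilateral u x v y around the midpoint of its diagonal u v; the diagonal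
  -- splits it into two triangles, each inside the polygon.
  refine ⟨{z | signedArea u x z < 0} ∩ {z | signedArea x v z < 0} ∩ {z | signedArea v y z < 0} ∩
    {z | signedArea y u z < 0}, ?_, ?_, ?_⟩
  · rintro z ⟨⟨⟨h1, h2⟩, h3⟩, h4⟩
    simp only [Set.mem_ofPred_eq] at h1 h2 h3 h4
    rcases le_total (signedArea u v z) 0 with h | h
    · exact mem_convexHull_of_signedArea_nonpos (hmem _) (hmem _) (hmem _) huvy h h3.le h4.le
    · refine mem_convexHull_of_signedArea_nonpos (hmem _) (hmem _) (hmem _) huxv h1.le h2.le ?_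
      rw [signedArea_swap]
      linarith
  · exact (((isOpen_lt (continuous_signedArea _ _) continuous_const).inter
      (isOpen_lt (continuous_signedArea _ _) continuous_const)).inter
      (isOpen_lt (continuous_signedArea _ _) continuous_const)).inter
      (isOpen_lt (continuous_signedArea _ _) continuous_const)
  · have e1 : signedArea x v u = signedArea u x v := (signedArea_rotate u x v).symm
    have e2 : signedArea v y u = signedArea u v y := (signedArea_rotate u v y).symm
    have e3 : signedArea y u v = signedArea u v y := signedArea_rotate y u v
    simp only [Set.mem_inter_iff, Set.mem_ofPred_eq, signedArea_combination _ _ u v hhalf,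
      signedArea_left, signedArea_right, e1, e2, e3]
    refine ⟨⟨⟨?_, ?_⟩, ?_⟩, ?_⟩ <;> linarith

variable {π}

/-! ### From geometric triangulations to chords. -/

namespace Triangulation

/-- The edges of a triangulation, in terms of the clockwise distances of their ends from `a`. -/
def chords (S : π.Triangulation) (i j : ℕ) : Prop :=
  i < j ∧ j < n ∧ s(step a i, step a j) ∈ S.edges

theorem exists_chords (S : π.Triangulation) {e : Sym2 (Fin n)} (he : e ∈ S.edges) :
    ∃ i j, S.chords a i j ∧ e = s(step a i, step a j) := by
  obtain ⟨i, j, hij, hj, rfl⟩ := exists_chord a (S.maximal.prop.1 _ he)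
  exact ⟨i, j, ⟨hij, hj, he⟩, rfl⟩

theorem isChordTriangulation (S : π.Triangulation) : IsChordTriangulation n (S.chords a) where
  lt h := h.1
  bound h := h.2.1
  noncrossing := by
    rintro i j k m ⟨hij, hj, h1⟩ ⟨hkm, hm, h2⟩ ⟨h3, h4, h5⟩
    refine S.maximal.prop.2 h1 h2 (fun h => ?_) (π.crosses_of_interleaved a h3 h4 h5 hm)
    have := chord_inj a hij hj hkm hm h
    omega
  maximal := by
    intro i j hij hj h
    refine ⟨hij, hj, S.maximal.mem_of_prop_insert ⟨?_, ?_⟩⟩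
    · rintro e (rfl | he)
      · rw [Sym2.mk_isDiag_iff, step_inj a (by omega) hj]
        omega
      · exact S.maximal.prop.1 e he
    · refine S.maximal.prop.2.insert fun f hf hne => ?_
      obtain ⟨k, m, hkm, rfl⟩ := S.exists_chords a hf
      have h1 : ¬ π.Crosses s(step a i, step a j) s(step a k, step a m) := by
        refine π.not_crosses_of_not_interleaved a hij hj hkm.1 hkm.2.1 ?_ (h k m hkm).1
          (h k m hkm).2
        rintro ⟨rfl, rfl⟩
        exact hne rfl
      exact ⟨h1, fun h2 => h1 h2.symm⟩

theorem exists_isChordFlip {S S' : π.Triangulation} (h : π.flipGraph.Adj S S') :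
    ∃ p q r s, IsChordFlip (S.chords a) (S'.chords a) p q r s := by
  obtain ⟨h1, h2⟩ := h
  obtain ⟨e, he⟩ := Set.ncard_eq_one.1 h1
  obtain ⟨f, hf⟩ := Set.ncard_eq_one.1 h2
  have he' : e ∈ S.edges \ S'.edges := he ▸ rfl
  have hf' : f ∈ S'.edges \ S.edges := hf ▸ rfl
  obtain ⟨p, q, hpq, rfl⟩ := S.exists_chords a he'.1
  obtain ⟨r, s, hrs, rfl⟩ := S'.exists_chords a hf'.1
  refine ⟨p, q, r, s, hpq, fun h => he'.2 h.2.2, hrs, fun h => hf'.2 h.2.2, fun {i j} hij => ?_,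
    fun {i j} hij => ?_⟩
  · by_cases hc : s(step a i, step a j) ∈ S'.edges
    · exact Or.inr ⟨hij.1, hij.2.1, hc⟩
    · have : s(step a i, step a j) ∈ S.edges \ S'.edges := ⟨hij.2.2, hc⟩
      rw [he] at this
      exact Or.inl (chord_inj a hij.1 hij.2.1 hpq.1 hpq.2.1 this)
  · by_cases hc : s(step a i, step a j) ∈ S.edges
    · exact Or.inr ⟨hij.1, hij.2.1, hc⟩
    · have : s(step a i, step a j) ∈ S'.edges \ S.edges := ⟨hij.2.2, hc⟩
      rw [hf] at this
      exact Or.inl (chord_inj a hij.1 hij.2.1 hrs.1 hrs.2.1 this)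

theorem flipPotential_le_length {l : ℕ} {S U : π.Triangulation} (w : π.flipGraph.Walk S U)
    (hU : flipPotential n l (U.chords a) (U.chords a) = 0) :
    flipPotential n l (U.chords a) (S.chords a) ≤ w.length := by
  induction w with
  | nil => simp [hU]
  | @cons _ _ U h w ih =>
    obtain ⟨p, q, r, s, hf⟩ := exists_isChordFlip a h
    have h1 := hf.flipPotential_le (l := l) (Q := U.chords a)
      (isChordTriangulation a _) (isChordTriangulation a _)
    rw [SimpleGraph.Walk.length_cons]
    exact h1.trans (Nat.add_le_add_right (ih hU) 1)

/-- A vertex that is incident to two interior edges has two neighbours besides the next ones. -/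
theorem exists_two_chords (U : π.Triangulation) {x : ℕ} (hx : x < n)
    (h : 2 ≤ {e | e ∈ U.interiorEdges ∧ step a x ∈ e}.ncard) :
    ∃ y z, y ≠ z ∧ (U.chords a x y ∨ U.chords a y x) ∧ (U.chords a x z ∨ U.chords a z x) ∧
      x + 1 ≠ y ∧ y + 1 ≠ x ∧ x + 1 ≠ z ∧ z + 1 ≠ x := by
  obtain ⟨e, f, ⟨he, hxe⟩, ⟨hf, hxf⟩, hef⟩ := (Set.one_lt_ncard_iff (Set.toFinite _)).1 h
  have key : ∀ e ∈ U.interiorEdges, step a x ∈ e → ∃ y, e = s(step a x, step a y) ∧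
      (U.chords a x y ∨ U.chords a y x) ∧ x + 1 ≠ y ∧ y + 1 ≠ x := by
    rintro e ⟨he, hb⟩ hxe
    obtain ⟨v, rfl⟩ := Sym2.mem_iff_exists.1 hxe
    obtain ⟨y, hy, rfl⟩ := exists_step a v
    refine ⟨y, rfl, ?_, ?_, ?_⟩
    · have hne := U.maximal.prop.1 _ he
      rw [Sym2.mk_isDiag_iff, step_inj a hx hy] at hne
      rcases lt_or_gt_of_ne hne with h | h
      · exact Or.inl ⟨h, hy, he⟩
      · exact Or.inr ⟨h, hx, Sym2.eq_swap ▸ he⟩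
    · rintro rfl
      exact hb (π.isBoundary_succ a hy)
    · rintro rfl
      exact hb (Sym2.eq_swap ▸ π.isBoundary_succ a hx)
  obtain ⟨y, rfl, hy, hy1, hy2⟩ := key e he hxe
  obtain ⟨z, rfl, hz, hz1, hz2⟩ := key f hf hxf
  refine ⟨y, z, ?_, hy, hz, hy1, hy2, hz1, hz2⟩
  rintro rfl
  exact hef rfl

theorem mem_interiorEdges_of_chords {S : π.Triangulation} {i j : ℕ} (h : S.chords a i j)
    (hij : i + 2 ≤ j) (h0 : ¬ (i = 0 ∧ j + 1 = n)) :
    s(step a i, step a j) ∈ S.interiorEdges :=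
  ⟨h.2.2, π.not_isBoundary a hij h.2.1 h0⟩

end Triangulation

open Finset Classical in
theorem card_linked_le_ncard_linkedRight (T U : π.Triangulation) {l : ℕ} (hl : l < n) :
    #{y ∈ Ioo (l + 1) (n - 1) | (T.chords a 0 y ∨ T.chords a l y) ∧ ∃ x ≤ l, U.chords a x y} ≤
      (linkedRight T U a (step a l)).ncard := by
  rw [← card_image_of_injOn (f := step a), ← Set.ncard_coe_finset]
  · refine Set.ncard_le_ncard ?_ (Set.toFinite _)
    intro v hv
    simp only [coe_image, Set.mem_image, mem_coe, mem_filter, mem_Ioo] at hv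
    obtain ⟨y, ⟨⟨hy1, hy2⟩, hT, x, hx, hU⟩, rfl⟩ := hv
    refine ⟨?_, ?_, step a x, ?_, ?_⟩
    · rw [rightOf, Set.mem_ofPred_eq, orientedLength_step a hl, orientedLength_step a (by omega)]
      omega
    · rcases hT with hT | hT
      · have := Triangulation.mem_interiorEdges_of_chords a hT (by omega) (by omega)
        rw [step_zero, Sym2.eq_swap] at this
        exact Or.inl this
      · have := Triangulation.mem_interiorEdges_of_chords a hT (by omega) (by omega)
        rw [Sym2.eq_swap] at this
        exact Or.inr this
    · rw [rightOf, Set.mem_ofPred_eq, orientedLength_step a hl, orientedLength_step a (by omega)]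
      omega
    · rw [Sym2.eq_swap]
      exact Triangulation.mem_interiorEdges_of_chords a hU (by omega) (by omega)
  · intro y hy z hz h
    simp only [coe_filter, mem_Ioo, Set.mem_ofPred_eq] at hy hz
    exact (step_inj a (by omega) (by omega)).1 h

end ConvexPolygon

/-! ### The distance bound. -/

theorem mainTheorem5 {n : ℕ} (π : ConvexPolygon n) (T : π.Triangulation) (a b : Fin n)
    (l : ℕ) (hl : ConvexPolygon.orientedLength a b = l)
    (hlen : (l : ℤ) ≤ ⌈(n : ℝ) / 2⌉ - 1)
    (hab : s(a, b) ∈ T.edges)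
    (U : π.Triangulation) (hU : U ∈ ConvexPolygon.omegaTilde T a b)
    (m : ℕ) (hm : (ConvexPolygon.linkedRight T U a b).ncard = m) :
    ((n + l : ℕ) : ℕ∞) ≤ ConvexPolygon.flipDist T U + m + 5 := by
  open ConvexPolygon in
  have hn := π.three_le
  obtain ⟨l', hl', rfl⟩ := exists_step a b
  obtain rfl : l' = l := by rw [← hl, orientedLength_step a hl']
  have hl1 : 1 ≤ l' := by
    by_contra hc
    obtain rfl : l' = 0 := by omega
    rw [step_zero] at hab
    exact T.maximal.prop.1 _ hab (Sym2.mk_isDiag_iff.2 rfl)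
  have hl2 : l' + 1 < n := by
    have h1 := Int.ceil_lt_add_one ((n : ℝ) / 2)
    have h2 : (l' : ℝ) ≤ (⌈(n : ℝ) / 2⌉ : ℝ) - 1 := by exact_mod_cast hlen
    have h3 : (2 * l' : ℝ) < n := by linarith
    have h4 : 2 * l' < n := by exact_mod_cast h3
    omega
  have hTab : T.chords a 0 l' := ⟨hl1, hl', by rwa [step_zero]⟩
  have hdeg := fun x (hx0 : 0 < x) (hx : x < l') =>
    U.exists_two_chords a (x := x) (by omega) (hU.2 (step a x) (by
      rw [leftOf, Set.mem_ofPred_eq, orientedLength_step a (by omega), orientedLength_step a hl']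
      exact ⟨hx0, hx⟩))
  -- A chord with both ends on the right meets neither a nor b, so T and U cannot share it.
  have hRR : ∀ i j, l' < i → i + 2 ≤ j → T.chords a i j → ¬ U.chords a i j := by
    intro i j hi hij hT hQ
    have hj := hT.2.1
    have h := hU.1 _ ⟨Triangulation.mem_interiorEdges_of_chords a hT hij (by omega),
      Triangulation.mem_interiorEdges_of_chords a hQ hij (by omega)⟩
    have h0 : ∀ k, k < n → (a = step a k ↔ 0 = k) := fun k hk => by
      rw [← step_inj a (by omega) hk, step_zero]
    rw [Sym2.mem_iff, Sym2.mem_iff, h0 i (by omega), h0 j hj, step_inj a hl' (by omega),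
      step_inj a hl' hj] at h
    omega
  have hTU := le_flipPotential (T.isChordTriangulation a) (U.isChordTriangulation a) hl1 hl2 hTab
    hdeg hRR
  have hcard := card_linked_le_ncard_linkedRight a T U hl'
  rw [hm] at hcard
  have hpot : (flipPotential n l' (U.chords a) (T.chords a) : ℕ∞) ≤ flipDist T U := by
    refine le_iInf fun w => ?_
    exact_mod_cast Triangulation.flipPotential_le_length a w
      (flipPotential_self (U.isChordTriangulation a) hdeg)
  have hnat : n + l' ≤ flipPotential n l' (U.chords a) (T.chords a) + m + 5 := by omega
  calc ((n + l' : ℕ) : ℕ∞) ≤ ((flipPotential n l' (U.chords a) (T.chords a) + m + 5 : ℕ) : ℕ∞) := by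
        exact_mod_cast hnat
    _ = (flipPotential n l' (U.chords a) (T.chords a) : ℕ∞) + m + 5 := by push_cast; rfl
    _ ≤ flipDist T U + m + 5 := by gcongr
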